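/- For $N\in\mathbb N$ let $C(S^{N-1}_{\mathbb R,+})$ be the universal (unital) $C^*$-algebra generated by elements $x_1,\ldots,x_N$ subject to $x_i=x_i^*$ and $\sum_i x_i^2=1$; the noncommutative compact space $S^{N-1}_{\mathbb R,+}$ is called the free sphere. A closed subspace $S\subset S^{N-1}_{\mathbb R,+}$ is a quotient $C(S)$ of this algebra by a closed two-sided ideal, and two closed subspaces are equal when their ideals are equal. The subspace obtained by imposing a family of relations $a_r=b_r$ is the one whose ideal is the closed two-sided ideal generated by the elements $a_r-b_r$. The half-liberated sphere $S^{N-1}_{\mathbb R,*}$ is obtained by imposing $x_ix_jx_k=x_kx_jx_i$ for all $i,j,k$. The real sphere $S^{N-1}_{\mathbb R}=\{p\in\mathbb R^N\mid\sum_ip_i^2=1\}$ is regarded as a closed subspace through the morphism $C(S^{N-1}_{\mathbb R,+})\to C(S^{N-1}_{\mathbb R})$ which sends $x_i$ to the $i$-th coordinate function. A monomial sphere is a closed subspace of $S^{N-1}_{\mathbb R,+}$ obtained by imposing, for all $\sigma$ in some set $E\subset\bigsqcup_{k\ge0}S_k$, the relations $$x_{i_1}\cdots x_{i_k}=x_{i_{\sigma(1)}}\cdots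 x_{i_{\sigma(k)}}\qquad\text{for all }(i_1,\ldots,i_k)\in\{1,\ldots,N\}^k,$$ where $k$ is such that $\sigma\in S_k$. Let $S_\infty=\bigcup_kS_k$, with $S_k\subset S_{k+1}$ given by $\sigma(k+1)=k+1$. A filtered subgroup of $S_\infty$ is a subgroup $G$ such that, with $G_k=G\cap S_k$, the concatenation of any $\sigma\in G_k$ and $\pi\in G_l$ (the permutation in $S_{k+l}$ acting as $\sigma$ on the first $k$ points and as $\pi$ on the last $l$ points) belongs to $G_{k+l}$. Let $S_\infty^*\subset S_\infty$ be the subgroup of the permutations such that $\sigma(i)$ and $i$ have the same parity for all $i$. Represent $\sigma\in S_k$ by the diagram with strings joining the upper point $i$ to the lower point $\sigma(i)$, $1\le i\le k$. Say that $G$ is stable under removing outer strings if, for any $\sigma\in G_k$ with $\sigma(1)=1$ (respectively $\sigma(k)=k$), the permutation in $S_{k-1}$ obtained by deleting the string at $1$ (respectively at $k$) belongs to $G_{k-1}$; and that $G$ is stable under removing neighbouring strings if, for any $\sigma\in G_k$ and any $p<k$ with $|\sigma(p)-\sigma(p+1)|=1$, the permutation in $S_{k-2}$ obtained by deleting the strings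 at $p$ and $p+1$ belongs to $G_{k-2}$. **Theorem 2.8.** 1. For any $N$, a closed subspace of $S^{N-1}_{\mathbb R,+}$ is a monomial sphere if and only if it is one of the three spheres $S^{N-1}_{\mathbb R}\subset S^{N-1}_{\mathbb R,*}\subset S^{N-1}_{\mathbb R,+}$. 2. A filtered subgroup $G\subset S_\infty$ is stable under removing outer strings and under removing neighbouring strings if and only if $G$ is one of $\{1\}$, $S_\infty^*$, $S_\infty$. -/

import Mathlib

open scoped ENNReal

noncomputable section

namespace MonomialSphere

/-! ### The free sphere -/

/-- A family `x₁, …, x_N` of self-adjoint elements with `∑ xᵢ² = 1` in a (nonzero) unital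
C⋆-algebra. -/
structure SphereModel (N : ℕ) : Type 1 where
  /-- the C⋆-algebra -/
  B : Type
  [cstar : CStarAlgebra B]
  [nontriv : Nontrivial B]
  /-- the coordinates -/
  x : Fin N → B
  selfAdjoint : ∀ i, star (x i) = x i
  sum_sq : ∑ i, x i ^ 2 = 1

attribute [instance] SphereModel.cstar SphereModel.nontriv

/-- The `ℓ^∞`-product of all the models. -/
abbrev ModelProduct (N : ℕ) : Type 1 := lp (fun ρ : SphereModel N => ρ.B) ∞

instance (N : ℕ) : CStarAlgebra (ModelProduct N) where

/-- In any model, the coordinates have norm at most `1`. -/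
theorem SphereModel.norm_x_le {N : ℕ} (ρ : SphereModel N) (i : Fin N) : ‖ρ.x i‖ ≤ 1 := by
  let _ := CStarAlgebra.spectralOrder ρ.B
  have _ := CStarAlgebra.spectralOrderedRing ρ.B
  have hnn : ∀ j, 0 ≤ ρ.x j ^ 2 := fun j => by
    have h := star_mul_self_nonneg (ρ.x j)
    rwa [ρ.selfAdjoint j, ← pow_two] at h
  have hle : ρ.x i ^ 2 ≤ 1 := by
    rw [← ρ.sum_sq]
    exact Finset.single_le_sum (f := fun j => ρ.x j ^ 2) (fun j _ => hnn j) (Finset.mem_univ i)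
  have h1 : ‖ρ.x i ^ 2‖ ≤ 1 := by
    have h := CStarAlgebra.norm_le_norm_of_nonneg_of_le (hnn i) hle
    rwa [norm_one] at h
  have h2 : ‖ρ.x i ^ 2‖ = ‖ρ.x i‖ * ‖ρ.x i‖ := by
    rw [pow_two]
    nth_rewrite 1 [← ρ.selfAdjoint i]
    exact CStarRing.norm_star_mul_self
  nlinarith [norm_nonneg (ρ.x i)]

/-- The universal coordinates: the tuples of the `i`-th coordinates in all models. -/
def universalCoord (N : ℕ) (i : Fin N) : ModelProduct N :=
  ⟨fun ρ => ρ.x i, memℓp_infty ⟨1, by rintro _ ⟨ρ, rfl⟩; exact ρ.norm_x_le i⟩⟩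

/-- `C(S^{N-1}_{ℝ,+})`, the universal C⋆-algebra generated by self-adjoint elements `x₁, …, x_N`
with `∑ xᵢ² = 1`. It is the C⋆-algebra generated by the universal coordinates, so that the norm of
a ⋆-polynomial in the coordinates is the supremum of its norms in all models, that is, the biggest
C⋆-norm. (A C⋆-algebra generated by `N` elements is separable, so it has at most continuum many
elements, and models with `B : Type` exhaust all models up to isomorphism.) -/
abbrev FreeSphereAlg (N : ℕ) : Type 1 :=
  (StarAlgebra.adjoin ℂ (Set.range (universalCoord N))).topologicalClosure

instance (N : ℕ) : IsClosed
    (((StarAlgebra.adjoin ℂ (Set.range (universalCoord N))).topologicalClosure :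
      StarSubalgebra ℂ (ModelProduct N)) : Set (ModelProduct N)) :=
  StarSubalgebra.isClosed_topologicalClosure _

instance (N : ℕ) : CStarAlgebra (FreeSphereAlg N) := StarSubalgebra.cstarAlgebra _

/-- The standard coordinates `x₁, …, x_N ∈ C(S^{N-1}_{ℝ,+})`. -/
def coord {N : ℕ} (i : Fin N) : FreeSphereAlg N :=
  ⟨universalCoord N i, StarSubalgebra.le_topologicalClosure _
    (StarAlgebra.subset_adjoin ℂ _ ⟨i, rfl⟩)⟩

/-- The canonical unital ⋆-homomorphism `C(S^{N-1}_{ℝ,+}) → B` to a model, `xᵢ ↦ xᵢ`. -/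
def evalModel {N : ℕ} (ρ : SphereModel N) : FreeSphereAlg N →⋆ₐ[ℂ] ρ.B where
  toFun a := (a : ModelProduct N) ρ
  map_one' := rfl
  map_mul' _ _ := rfl
  map_zero' := rfl
  map_add' _ _ := rfl
  commutes' _ := rfl
  map_star' _ := rfl

theorem evalModel_coord {N : ℕ} (ρ : SphereModel N) (i : Fin N) :
    evalModel ρ (coord i) = ρ.x i := rfl

/-- The relations of the free sphere hold for the standard coordinates. -/
theorem star_coord {N : ℕ} (i : Fin N) : star (coord i) = coord i := by
  apply Subtype.ext
  apply lp.ext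
  funext ρ
  exact ρ.selfAdjoint i

theorem sum_coord_sq (N : ℕ) : ∑ i : Fin N, coord i ^ 2 = (1 : FreeSphereAlg N) := by
  apply Subtype.ext
  apply lp.ext
  funext ρ
  have h : evalModel ρ (∑ i : Fin N, coord i ^ 2) = evalModel ρ 1 := by
    rw [map_sum, map_one, ← ρ.sum_sq]
    exact Finset.sum_congr rfl fun i _ => by rw [map_pow, evalModel_coord]
  exact h

theorem continuous_evalModel {N : ℕ} (ρ : SphereModel N) : Continuous (evalModel ρ) := by
  refine AddMonoidHomClass.continuous_of_bound (evalModel ρ) 1 fun a => ?_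
  rw [one_mul]
  exact lp.norm_apply_le_norm ENNReal.top_ne_zero (a : ModelProduct N) ρ

/-- Universality: `evalModel ρ` is the only ⋆-homomorphism respecting the coordinates. -/
theorem eq_evalModel {N : ℕ} (ρ : SphereModel N) (φ : FreeSphereAlg N →⋆ₐ[ℂ] ρ.B)
    (h : ∀ i, φ (coord i) = ρ.x i) : φ = evalModel ρ := by
  refine StarAlgHom.ext_topologicalClosure
    (AddMonoidHomClass.continuous_of_bound φ 1 fun a => by
      rw [one_mul]; exact NonUnitalStarAlgHom.norm_apply_le φ a)
    (continuous_evalModel ρ) ?_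
  refine StarAlgHom.ext_adjoin fun a ha => ?_
  obtain ⟨i, hi⟩ := ha
  have ha' : StarSubalgebra.inclusion (StarSubalgebra.le_topologicalClosure _) a = coord i :=
    Subtype.ext hi.symm
  change φ (StarSubalgebra.inclusion (StarSubalgebra.le_topologicalClosure _) a) =
    evalModel ρ (StarSubalgebra.inclusion (StarSubalgebra.le_topologicalClosure _) a)
  rw [ha', h, evalModel_coord]

/-! ### Closed subspaces of the free sphere -/

/-- A closed subspace `S ⊂ S^{N-1}_{ℝ,+}`, that is, a quotient C⋆-algebra `C(S)` of
`C(S^{N-1}_{ℝ,+})`, given by its kernel, a closed two-sided ideal (such an ideal of a C⋆-algebra is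
automatically stable under `⋆`). -/
@[ext]
structure ClosedSubspace (N : ℕ) : Type 1 where
  /-- the kernel of `C(S^{N-1}_{ℝ,+}) → C(S)` -/
  ideal : TwoSidedIdeal (FreeSphereAlg N)
  isClosed : IsClosed (ideal : Set (FreeSphereAlg N))

/-- The closed subspace obtained by imposing the relations `a = b`, for `(a, b) ∈ R`: its ideal is
the smallest closed two-sided ideal containing all the elements `a - b`. -/
def cutOut {N : ℕ} (R : Set (FreeSphereAlg N × FreeSphereAlg N)) : ClosedSubspace N where
  ideal := sInf {I | IsClosed (I : Set (FreeSphereAlg N)) ∧ ∀ r ∈ R, r.1 - r.2 ∈ I}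
  isClosed := by
    have h : ((sInf {I : TwoSidedIdeal (FreeSphereAlg N) |
        IsClosed (I : Set (FreeSphereAlg N)) ∧ ∀ r ∈ R, r.1 - r.2 ∈ I} :
          TwoSidedIdeal (FreeSphereAlg N)) : Set (FreeSphereAlg N)) =
        ⋂ I ∈ {I : TwoSidedIdeal (FreeSphereAlg N) |
          IsClosed (I : Set (FreeSphereAlg N)) ∧ ∀ r ∈ R, r.1 - r.2 ∈ I},
          (I : Set (FreeSphereAlg N)) := by
      ext a
      simp only [Set.mem_iInter, SetLike.mem_coe]
      exact TwoSidedIdeal.mem_sInf _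
    rw [h]
    exact isClosed_biInter fun I hI => hI.1

/-! ### The three spheres -/

/-- The free sphere `S^{N-1}_{ℝ,+}`, as a subspace of itself. -/
def freeSphere (N : ℕ) : ClosedSubspace N where
  ideal := ⊥
  isClosed := by
    rw [TwoSidedIdeal.coe_bot]
    exact isClosed_singleton

/-- The half-liberated sphere `S^{N-1}_{ℝ,*}`: the relations are `xᵢxⱼxₖ = xₖxⱼxᵢ`. -/
def halfLiberatedSphere (N : ℕ) : ClosedSubspace N :=
  cutOut {r | ∃ i j k : Fin N,
    r = (coord i * coord j * coord k, coord k * coord j * coord i)}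

/-- The points `p ∈ ℝ^N` with `∑ pᵢ² = 1`. -/
abbrev RealPoint (N : ℕ) : Type := {p : Fin N → ℝ // ∑ i, p i ^ 2 = 1}

/-- A point of the usual sphere, seen as a model of the coordinates in `ℂ`. -/
def pointModel {N : ℕ} (p : RealPoint N) : SphereModel N where
  B := ℂ
  x i := (p.1 i : ℂ)
  selfAdjoint i := Complex.conj_ofReal (p.1 i)
  sum_sq := by exact_mod_cast congrArg (fun t : ℝ => (t : ℂ)) p.2

/-- The usual sphere `S^{N-1}_ℝ = {p ∈ ℝ^N | ∑ pᵢ² = 1}`, as a closed subspace of the free sphere.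
The ideal is the kernel of the restriction map `C(S^{N-1}_{ℝ,+}) → C(S^{N-1}_ℝ)`, `xᵢ ↦ (p ↦ pᵢ)`,
and consists of the elements which vanish at all points of the usual sphere. -/
def realSphere (N : ℕ) : ClosedSubspace N where
  ideal := ⨅ p : RealPoint N, TwoSidedIdeal.ker (evalModel (pointModel p))
  isClosed := by
    have h : ((⨅ p : RealPoint N, TwoSidedIdeal.ker (evalModel (pointModel p)) :
        TwoSidedIdeal (FreeSphereAlg N)) : Set (FreeSphereAlg N)) =
        ⋂ p : RealPoint N, evalModel (pointModel p) ⁻¹' {0} := by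
      ext a
      simp only [Set.mem_iInter, SetLike.mem_coe, Set.mem_preimage, Set.mem_singleton_iff]
      refine (TwoSidedIdeal.mem_iInf _).trans (forall_congr' fun p => ?_)
      exact TwoSidedIdeal.mem_ker (evalModel (pointModel p))
    rw [h]
    exact isClosed_iInter fun p => isClosed_singleton.preimage (continuous_evalModel _)

/-! ### Monomial spheres -/

/-- The monomial `x_{i₁} ⋯ x_{iₖ}`. -/
def monomial {N k : ℕ} (i : Fin k → Fin N) : FreeSphereAlg N :=
  (List.ofFn fun j => coord (i j)).prod

/-- The relations `x_{i₁} ⋯ x_{iₖ} = x_{i_{σ(1)}} ⋯ x_{i_{σ(k)}}`, for all indices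
`(i₁, …, iₖ)`. -/
def permRelations (N : ℕ) {k : ℕ} (σ : Equiv.Perm (Fin k)) :
    Set (FreeSphereAlg N × FreeSphereAlg N) :=
  {r | ∃ i : Fin k → Fin N, r = (monomial i, monomial fun j => i (σ j))}

/-- A monomial sphere is a closed subspace of the free sphere obtained by imposing the relations
associated to certain permutations, of variable size. -/
def IsMonomialSphere {N : ℕ} (S : ClosedSubspace N) : Prop :=
  ∃ E : Set (Σ k : ℕ, Equiv.Perm (Fin k)), S = cutOut (⋃ σ ∈ E, permRelations N σ.2)

/-! ### Filtered subgroups of `S_∞` -/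

/-- Concatenation `S_k × S_l → S_{k+l}`: the diagram of `σ` followed, at right, by that of `π`. -/
def concat {k l : ℕ} (σ : Equiv.Perm (Fin k)) (π : Equiv.Perm (Fin l)) :
    Equiv.Perm (Fin (k + l)) :=
  finSumFinEquiv.permCongr (Equiv.Perm.sumCongr σ π)

/-- A filtered subgroup `G ⊂ S_∞`, where `S_∞ = ⋃ S_k` with `S_k ⊂ S_{k+1}` by adding a fixed point
at right. It is written `G = (G_k)`, with `G_k = G ∩ S_k` (this is `mem_succ_iff`), and has to be
stable under concatenation. -/
@[ext]
structure FilteredSubgroup where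
  /-- the component `G_k ⊂ S_k` -/
  level : ∀ k : ℕ, Subgroup (Equiv.Perm (Fin k))
  mem_succ_iff : ∀ {k : ℕ} (σ : Equiv.Perm (Fin k)),
    concat σ (1 : Equiv.Perm (Fin 1)) ∈ level (k + 1) ↔ σ ∈ level k
  concat_mem : ∀ {k l : ℕ} {σ : Equiv.Perm (Fin k)} {π : Equiv.Perm (Fin l)},
    σ ∈ level k → π ∈ level l → concat σ π ∈ level (k + l)

theorem concat_castAdd {k l : ℕ} (σ : Equiv.Perm (Fin k)) (π : Equiv.Perm (Fin l)) (i : Fin k) :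
    concat σ π (Fin.castAdd l i) = Fin.castAdd l (σ i) := by
  simp [concat, Equiv.permCongr_apply]

theorem concat_natAdd {k l : ℕ} (σ : Equiv.Perm (Fin k)) (π : Equiv.Perm (Fin l)) (i : Fin l) :
    concat σ π (Fin.natAdd k i) = Fin.natAdd k (π i) := by
  simp [concat, Equiv.permCongr_apply]

/-- The trivial filtered subgroup `{1}`. -/
def trivialGroup : FilteredSubgroup where
  level _ := ⊥
  mem_succ_iff {k} σ := by
    simp only [Subgroup.mem_bot]
    constructor
    · intro h
      ext i
      have := concat_castAdd σ (1 : Equiv.Perm (Fin 1)) i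
      rw [h] at this
      simpa using (congrArg Fin.val this).symm
    · rintro rfl
      ext i
      refine Fin.addCases (fun i => ?_) (fun i => ?_) i
      · rw [concat_castAdd]; rfl
      · rw [concat_natAdd]; rfl
  concat_mem {k l σ π} hσ hπ := by
    simp only [Subgroup.mem_bot] at *
    subst hσ hπ
    ext i
    refine Fin.addCases (fun i => ?_) (fun i => ?_) i
    · rw [concat_castAdd]; rfl
    · rw [concat_natAdd]; rfl

/-- The full group `S_∞`. -/
def fullGroup : FilteredSubgroup where
  level _ := ⊤
  mem_succ_iff _ := by simp
  concat_mem _ _ := Subgroup.mem_top _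

/-- The group `S_∞^*`. When the upper legs are labelled `∘•∘•…` and the lower legs `•∘•∘…`, each
string must join a black leg to a white leg, which means that `σ(i)` and `i` have the same
parity. -/
def parityGroup : FilteredSubgroup where
  level k :=
    { carrier := {σ | ∀ i : Fin k, (σ i).val % 2 = i.val % 2}
      mul_mem' := fun {σ π} hσ hπ i => (hσ (π i)).trans (hπ i)
      one_mem' := fun _ => rfl
      inv_mem' := fun {σ} hσ i => by
        have h := hσ (σ⁻¹ i)
        have e : σ (σ⁻¹ i) = i := σ.apply_symm_apply i
        rw [e] at h
        exact h.symm }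
  mem_succ_iff {k} σ := by
    constructor
    · intro h i
      have h' := h (Fin.castAdd 1 i)
      rw [concat_castAdd] at h'
      simpa using h'
    · intro h i
      refine Fin.addCases (fun i => ?_) (fun i => ?_) i
      · rw [concat_castAdd]; simpa using h i
      · rw [concat_natAdd]; rfl
  concat_mem {k l σ π} hσ hπ := by
    intro i
    refine Fin.addCases (fun i => ?_) (fun i => ?_) i
    · rw [concat_castAdd]; simpa using hσ i
    · rw [concat_natAdd]
      have h := hπ i
      simp only [Fin.val_natAdd]
      omega

/-- `σ` is obtained from the diagram of `τ` by removing the string which starts at the upper leg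
`p` and ends at the lower leg `τ p`. -/
def RemovesString {k : ℕ} (p : Fin (k + 1)) (τ : Equiv.Perm (Fin (k + 1)))
    (σ : Equiv.Perm (Fin k)) : Prop :=
  ∀ j : Fin k, τ (p.succAbove j) = (τ p).succAbove (σ j)

/-- Stability under removing outer strings: a string joining the leftmost upper leg to the leftmost
lower leg, or the rightmost upper leg to the rightmost lower leg. -/
def StableRemovingOuter (G : FilteredSubgroup) : Prop :=
  ∀ (k : ℕ) (τ : Equiv.Perm (Fin (k + 1))) (σ : Equiv.Perm (Fin k)), τ ∈ G.level (k + 1) →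
    ((τ 0 = 0 ∧ RemovesString 0 τ σ) ∨
      (τ (Fin.last k) = Fin.last k ∧ RemovesString (Fin.last k) τ σ)) →
    σ ∈ G.level k

/-- Stability under removing neighbouring strings: two strings starting at neighbouring upper legs
`p`, `p + 1` and ending at neighbouring lower legs, in any order, can be removed together (first
the one at `p + 1`, then the one at `p`). -/
def StableRemovingNeighbours (G : FilteredSubgroup) : Prop :=
  ∀ (k : ℕ) (p : Fin (k + 1)) (τ : Equiv.Perm (Fin (k + 2))) (ρ : Equiv.Perm (Fin (k + 1)))
    (σ : Equiv.Perm (Fin k)), τ ∈ G.level (k + 2) →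
    ((τ p.succ).val = (τ p.castSucc).val + 1 ∨ (τ p.castSucc).val = (τ p.succ).val + 1) →
    RemovesString p.succ τ ρ → RemovesString p ρ σ →
    σ ∈ G.level k

end MonomialSphere

end

/-!
The permutations whose relations hold on a given closed subspace of the free sphere form a filtered
subgroup of `S_∞`, and summing the relations over a repeated index, with `∑ xᵢ² = 1`, shows that it
is stable under removing outer and neighbouring strings. A monomial sphere is recovered from this
group, so the first assertion follows from the second one.

If `f ≠ 1` belongs to a stable group, translate `f` so that the first point moved by the translate
is the last point moved by `f`. The commutator of the two permutations is a `3`-cycle, and removing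
outer and neighbouring strings reduces it to the transposition `(0 1)` or `(0 2)`. The translates of
the former generate `S_∞`, and those of the latter generate `S_∞^*`, over which any element that
breaks parity produces `(0 1)`.

The subgroup `S_∞` gives the real sphere because a closed two-sided ideal with commutative quotient
contains every element on which all the characters killing the ideal vanish, and the characters of
`C(S^{N-1}_{ℝ,+})` are the points of the real sphere.
-/

noncomputable section

namespace MonomialSphere

open Equiv Equiv.Perm MulAction
open scoped commutatorElement

/-! ### Permutations of the natural numbers -/

section ViaEmbedding

variable {α β γ : Type*}

theorem eq_viaEmbedding {f : Perm α} {ι : α ↪ β} {g : Perm β} (h : ∀ a, g (ι a) = ι (f a))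
    (h' : ∀ b ∉ Set.range ι, g b = b) : g = f.viaEmbedding ι := by
  ext b
  by_cases hb : b ∈ Set.range ι
  · obtain ⟨a, rfl⟩ := hb
    rw [h, viaEmbedding_apply]
  · rw [h' b hb, viaEmbedding_apply_of_notMem _ _ _ hb]

theorem viaEmbedding_trans (f : Perm α) (ι : α ↪ β) (κ : β ↪ γ) :
    (f.viaEmbedding ι).viaEmbedding κ = f.viaEmbedding (ι.trans κ) := by
  refine eq_viaEmbedding (fun a => ?_) fun c hc => ?_
  · rw [Function.Embedding.trans_apply, viaEmbedding_apply, viaEmbedding_apply]; rfl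
  · by_cases h : c ∈ Set.range κ
    · obtain ⟨b, rfl⟩ := h
      rw [viaEmbedding_apply, viaEmbedding_apply_of_notMem]
      rintro ⟨a, rfl⟩
      exact hc ⟨a, rfl⟩
    · exact viaEmbedding_apply_of_notMem _ _ _ h

theorem viaEmbedding_mul (f g : Perm α) (ι : α ↪ β) :
    (f * g).viaEmbedding ι = f.viaEmbedding ι * g.viaEmbedding ι :=
  map_mul (viaEmbeddingHom ι) f g

theorem viaEmbedding_swap [DecidableEq α] [DecidableEq β] (ι : α ↪ β) (a b : α) :
    (swap a b).viaEmbedding ι = swap (ι a) (ι b) := by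
  refine (eq_viaEmbedding (fun x => (ι.injective.map_swap a b x).symm) fun x hx => ?_).symm
  exact swap_apply_of_ne_of_ne (fun h => hx ⟨a, h.symm⟩) fun h => hx ⟨b, h.symm⟩

theorem exists_viaEmbedding_eq (ι : α ↪ β) {g : Perm β} (hg : ∀ b ∉ Set.range ι, g b = b) :
    ∃ f : Perm α, f.viaEmbedding ι = g := by
  have hmem : ∀ b, b ∈ Set.range ι ↔ g b ∈ Set.range ι := fun b =>
    ⟨fun hb => by_contra fun h => h (by rwa [g.injective (hg _ h)]),
      fun hb => by_contra fun h => h (by rwa [hg b h] at hb)⟩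
  let e := ofInjective ι ι.injective
  refine ⟨e.symm.permCongr (g.subtypePerm fun b => (hmem b).symm), ?_⟩
  refine (eq_viaEmbedding (fun a => ?_) hg).symm
  have h : ι (e.symm ⟨g (ι a), _⟩) = g (ι a) :=
    congrArg Subtype.val (e.apply_symm_apply ⟨g (ι a), (hmem _).1 ⟨a, rfl⟩⟩)
  exact h.symm

end ViaEmbedding

/-- The inclusion of `S_k` into the group of permutations of `ℕ`; the group `S_∞` is the union of
the images. -/
def toPermNat {k : ℕ} : Perm (Fin k) →* Perm ℕ := viaEmbeddingHom Fin.valEmbedding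

theorem toPermNat_injective {k : ℕ} : Function.Injective (toPermNat (k := k)) :=
  viaEmbeddingHom_injective _

theorem toPermNat_apply {k : ℕ} (σ : Perm (Fin k)) (i : Fin k) : toPermNat σ i = σ i :=
  viaEmbedding_apply _ _ _

theorem toPermNat_apply_of_le {k : ℕ} (σ : Perm (Fin k)) {i : ℕ} (hi : k ≤ i) :
    toPermNat σ i = i :=
  viaEmbedding_apply_of_notMem _ _ _ fun ⟨j, hj⟩ => hi.not_gt (hj ▸ j.2)

theorem toPermNat_swap {k : ℕ} (i j : Fin k) : toPermNat (swap i j) = swap (i : ℕ) j :=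
  viaEmbedding_swap _ _ _

theorem toPermNat_viaEmbedding {k l : ℕ} (σ : Perm (Fin k)) (ι : Fin k ↪ Fin l) (κ : ℕ ↪ ℕ)
    (h : ∀ i, (ι i : ℕ) = κ i) : toPermNat (σ.viaEmbedding ι) = (toPermNat σ).viaEmbedding κ := by
  have hικ : ι.trans Fin.valEmbedding = Fin.valEmbedding.trans κ := by
    ext i
    exact h i
  simp only [toPermNat, viaEmbeddingHom_apply, viaEmbedding_trans, hικ]

theorem finite_compl_fixedBy_toPermNat {k : ℕ} (σ : Perm (Fin k)) :
    (fixedBy ℕ (toPermNat σ))ᶜ.Finite :=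
  (Set.finite_lt_nat k).subset fun _ hi => not_le.1 fun h => hi (toPermNat_apply_of_le σ h)

theorem exists_forall_le_of_finite {f : Perm ℕ} (hf : (fixedBy ℕ f)ᶜ.Finite) (m : ℕ) :
    ∃ k ≥ m, ∀ i, k ≤ i → f i = i := by
  obtain ⟨n, hn⟩ := hf.bddAbove
  refine ⟨max m (n + 1), le_max_left _ _, fun i hi => ?_⟩
  by_contra h
  have := hn h
  omega

theorem exists_toPermNat_eq {f : Perm ℕ} {k : ℕ} (hf : ∀ i, k ≤ i → f i = i) :
    ∃ σ : Perm (Fin k), toPermNat σ = f :=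
  exists_viaEmbedding_eq _ fun i hi => hf i (not_lt.1 fun h => hi ⟨⟨i, h⟩, rfl⟩)

theorem concat_one_right {k : ℕ} (σ : Perm (Fin k)) (l : ℕ) :
    concat σ (1 : Perm (Fin l)) = σ.viaEmbedding (Fin.castAddEmb l) := by
  refine eq_viaEmbedding (concat_castAdd σ 1) fun i hi => ?_
  induction i using Fin.addCases with
  | left i => exact absurd ⟨i, rfl⟩ hi
  | right i => exact concat_natAdd σ 1 i

theorem concat_one_left {l : ℕ} (k : ℕ) (π : Perm (Fin l)) :
    concat (1 : Perm (Fin k)) π = π.viaEmbedding (Fin.natAddEmb k) := by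
  refine eq_viaEmbedding (concat_natAdd 1 π) fun i hi => ?_
  induction i using Fin.addCases with
  | left i => exact concat_castAdd 1 π i
  | right i => exact absurd ⟨i, rfl⟩ hi

theorem toPermNat_concat_one_right {k : ℕ} (σ : Perm (Fin k)) (l : ℕ) :
    toPermNat (concat σ (1 : Perm (Fin l))) = toPermNat σ := by
  rw [concat_one_right]
  exact viaEmbedding_trans _ _ _

theorem toPermNat_concat_one_left {l : ℕ} (k : ℕ) (π : Perm (Fin l)) :
    toPermNat (concat (1 : Perm (Fin k)) π) =
      (toPermNat π).viaEmbedding (addLeftEmbedding k) := by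
  rw [concat_one_left]
  exact toPermNat_viaEmbedding _ _ _ fun _ => rfl

theorem removesString_viaEmbedding {k : ℕ} (p : Fin (k + 1)) (σ : Perm (Fin k)) :
    RemovesString p (σ.viaEmbedding p.succAboveEmb) σ := fun j => by
  have hp : σ.viaEmbedding p.succAboveEmb p = p :=
    viaEmbedding_apply_of_notMem _ _ _ fun ⟨i, hi⟩ => p.succAbove_ne i hi
  rw [hp]
  exact viaEmbedding_apply _ _ _

namespace FilteredSubgroup

variable (G : FilteredSubgroup)

theorem concat_one_mem_iff {k : ℕ} (σ : Perm (Fin k)) (l : ℕ) :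
    concat σ (1 : Perm (Fin l)) ∈ G.level (k + l) ↔ σ ∈ G.level k := by
  induction l with
  | zero =>
    have h : concat σ (1 : Perm (Fin 0)) = σ :=
      toPermNat_injective (toPermNat_concat_one_right σ 0)
    rw [h]; rfl
  | succ l ih =>
    have h : concat (concat σ (1 : Perm (Fin l))) (1 : Perm (Fin 1)) =
        concat σ (1 : Perm (Fin (l + 1))) :=
      toPermNat_injective <| by
        rw [toPermNat_concat_one_right, toPermNat_concat_one_right]
        exact (toPermNat_concat_one_right σ (l + 1)).symm
    rw [← ih, ← h]
    exact G.mem_succ_iff _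

/-- The group `⋃ G_k`, as a group of permutations of `ℕ`. -/
def union : Subgroup (Perm ℕ) := ⨆ k, (G.level k).map toPermNat

variable {G}

theorem mem_union {f : Perm ℕ} : f ∈ G.union ↔ ∃ k, ∃ σ ∈ G.level k, toPermNat σ = f := by
  refine Subgroup.mem_iSup_of_directed (Monotone.directed_le (monotone_nat_of_le_succ fun k => ?_))
  rintro _ ⟨σ, hσ, rfl⟩
  exact ⟨concat σ 1, (G.mem_succ_iff σ).2 hσ, toPermNat_concat_one_right σ 1⟩

theorem toPermNat_mem_union {k : ℕ} {σ : Perm (Fin k)} :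
    toPermNat σ ∈ G.union ↔ σ ∈ G.level k := by
  refine ⟨fun h => ?_, fun h => mem_union.2 ⟨k, σ, h, rfl⟩⟩
  obtain ⟨l, τ, hτ, h⟩ := mem_union.1 h
  rcases le_total k l with hkl | hlk
  · obtain ⟨m, rfl⟩ := Nat.exists_eq_add_of_le hkl
    rw [← toPermNat_concat_one_right σ m] at h
    rwa [toPermNat_injective h, concat_one_mem_iff] at hτ
  · obtain ⟨m, rfl⟩ := Nat.exists_eq_add_of_le hlk
    rw [← toPermNat_concat_one_right τ m] at h
    rwa [← toPermNat_injective h, concat_one_mem_iff]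

theorem finite_compl_fixedBy_of_mem_union {f : Perm ℕ} (hf : f ∈ G.union) :
    (fixedBy ℕ f)ᶜ.Finite := by
  obtain ⟨k, σ, -, rfl⟩ := mem_union.1 hf
  exact finite_compl_fixedBy_toPermNat σ

theorem translate_mem_union {f : Perm ℕ} (hf : f ∈ G.union) (m : ℕ) :
    f.viaEmbedding (addLeftEmbedding m) ∈ G.union := by
  obtain ⟨k, σ, hσ, rfl⟩ := mem_union.1 hf
  rw [← toPermNat_concat_one_left, toPermNat_mem_union]
  exact G.concat_mem (one_mem _) hσ

theorem mem_union_of_translate_one_mem (hG : StableRemovingOuter G) {f : Perm ℕ}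
    (h : f.viaEmbedding (addLeftEmbedding 1) ∈ G.union) : f ∈ G.union := by
  obtain ⟨k, -, hk⟩ := exists_forall_le_of_finite (finite_compl_fixedBy_of_mem_union h) 0
  have hf : ∀ i, k ≤ i → f i = i := fun i hi =>
    Nat.add_left_cancel <| (viaEmbedding_apply f (addLeftEmbedding 1) i).symm.trans <|
      hk (1 + i) (by omega)
  obtain ⟨σ, rfl⟩ := exists_toPermNat_eq hf
  rw [← toPermNat_viaEmbedding σ (Fin.succAboveEmb 0) (addLeftEmbedding 1)
    fun i => add_comm (i : ℕ) 1, toPermNat_mem_union] at h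
  have h0 : σ.viaEmbedding (Fin.succAboveEmb 0) 0 = 0 :=
    viaEmbedding_apply_of_notMem _ _ _ fun ⟨i, hi⟩ => Fin.succAbove_ne 0 i hi
  exact toPermNat_mem_union.2 (hG k _ σ h (.inl ⟨h0, removesString_viaEmbedding 0 σ⟩))

theorem mem_union_of_translate_mem (hG : StableRemovingOuter G) {f : Perm ℕ} {m : ℕ}
    (h : f.viaEmbedding (addLeftEmbedding m) ∈ G.union) : f ∈ G.union := by
  induction m generalizing f with
  | zero =>
    rwa [← eq_viaEmbedding (g := f) (fun i => ?_) fun i hi => ?_] at h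
    · simp
    · exact absurd ⟨i, zero_add i⟩ hi
  | succ m ih =>
    refine mem_union_of_translate_one_mem hG (ih ?_)
    have hm : (addLeftEmbedding 1).trans (addLeftEmbedding m) = addLeftEmbedding (m + 1) := by
      ext i
      exact (add_assoc m 1 i).symm
    rwa [viaEmbedding_trans, hm]

end FilteredSubgroup

/-! ### Reduction to transpositions -/

/-- The increasing map `ℕ → ℕ` which omits the values `p` and `p + 1`. -/
def skipTwo (p : ℕ) : ℕ ↪ ℕ where
  toFun j := if j < p then j else j + 2
  inj' i j h := by grind

theorem skipTwo_apply (p j : ℕ) : skipTwo p j = if j < p then j else j + 2 := rfl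

theorem val_succAbove_succ_succAbove {k : ℕ} (p : Fin (k + 1)) (j : Fin k) :
    (p.succ.succAbove (p.succAbove j) : ℕ) = skipTwo p j := by
  simp only [skipTwo_apply, Fin.succAbove, Fin.lt_def]
  grind

namespace FilteredSubgroup

variable {G : FilteredSubgroup}

theorem mem_union_of_viaEmbedding_skipTwo_mem (hG : StableRemovingNeighbours G) {f : Perm ℕ}
    {p : ℕ} (h : f.viaEmbedding (skipTwo p) ∈ G.union) : f ∈ G.union := by
  obtain ⟨k, hpk, hk⟩ := exists_forall_le_of_finite (finite_compl_fixedBy_of_mem_union h) p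
  have hf : ∀ i, k ≤ i → f i = i := fun i hi =>
    (skipTwo p).injective <| (viaEmbedding_apply f (skipTwo p) i).symm.trans <|
      hk _ (by grind [skipTwo_apply])
  obtain ⟨σ, rfl⟩ := exists_toPermNat_eq hf
  let p' : Fin (k + 1) := ⟨p, by omega⟩
  let ρ := σ.viaEmbedding p'.succAboveEmb
  let τ := ρ.viaEmbedding p'.succ.succAboveEmb
  have hτ : toPermNat τ = (toPermNat σ).viaEmbedding (skipTwo p) := by
    simp only [τ, ρ, viaEmbedding_trans]
    exact toPermNat_viaEmbedding _ _ _ fun j => val_succAbove_succ_succAbove p' j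
  have hρp : ρ p' = p' :=
    viaEmbedding_apply_of_notMem _ _ _ fun ⟨j, hj⟩ => p'.succAbove_ne j hj
  have hτ₁ : τ p'.succ = p'.succ :=
    viaEmbedding_apply_of_notMem _ _ _ fun ⟨j, hj⟩ => p'.succ.succAbove_ne j hj
  have hτ₂ : τ p'.castSucc = p'.castSucc := by
    have := viaEmbedding_apply ρ p'.succ.succAboveEmb p'
    rwa [hρp, Fin.succAboveEmb_apply, Fin.succAbove_succ_self] at this
  rw [← hτ, toPermNat_mem_union] at h
  refine toPermNat_mem_union.2 (hG k p' τ ρ σ h (.inl ?_) (removesString_viaEmbedding _ _)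
    (removesString_viaEmbedding _ _))
  rw [hτ₁, hτ₂, Fin.val_succ, Fin.val_castSucc]

end FilteredSubgroup

theorem commutator_eq_swap_mul_swap {α : Type*} [DecidableEq α] {f g : Perm α} {b : α}
    (hfg : ∀ x ≠ b, f x = x ∨ g x = x) (hb : g b ≠ b) :
    ⁅f, g⁆ = swap (f b) (g b) * swap b (g b) := by
  have hfgb : f (g b) = g b := (hfg _ hb).resolve_right fun h => hb (g.injective h)
  -- off `b`, the permutations `f` and `g` have disjoint supports
  have hcomm : Commute f (swap b (g b) * g) := by
    refine Disjoint.commute fun x => or_iff_not_imp_left.2 fun hx => ?_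
    rcases eq_or_ne x b with rfl | hxb
    · exact swap_apply_right _ _
    · rw [Perm.mul_apply, (hfg x hxb).resolve_left hx]
      exact swap_apply_of_ne_of_ne hxb fun h => hx (h ▸ hfgb)
  calc ⁅f, g⁆ = f * (swap b (g b) * (swap b (g b) * g)) * f⁻¹ * g⁻¹ := by
        rw [swap_mul_self_mul, commutatorElement_def]
    _ = f * swap b (g b) * f⁻¹ * (f * (swap b (g b) * g)) * f⁻¹ * g⁻¹ := by group
    _ = f * swap b (g b) * f⁻¹ * swap b (g b) := by rw [hcomm.eq]; group
    _ = swap (f b) (g b) * swap b (g b) := by rw [← swap_apply_apply, hfgb]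

/-- The `3`-cycle on the points `0 < u + 1 < u + v + 2` of `ℕ`, separated by gaps of `u` and of `v`
points. -/
def gapCycle (u v : ℕ) : Perm ℕ := swap 0 (u + v + 2) * swap (u + 1) (u + v + 2)

theorem gapCycle_viaEmbedding_skipTwo_left (u v : ℕ) :
    (gapCycle u v).viaEmbedding (skipTwo 1) = gapCycle (u + 2) v := by
  simp only [gapCycle, viaEmbedding_mul, viaEmbedding_swap, skipTwo_apply]
  grind

theorem gapCycle_viaEmbedding_skipTwo_right (u v : ℕ) :
    (gapCycle u v).viaEmbedding (skipTwo (u + 2)) = gapCycle u (v + 2) := by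
  simp only [gapCycle, viaEmbedding_mul, viaEmbedding_swap, skipTwo_apply]
  grind

theorem exists_extreme_moved {f : Perm ℕ} (hf : (fixedBy ℕ f)ᶜ.Finite) (hf1 : f ≠ 1) :
    ∃ a b, f a ≠ a ∧ f b ≠ b ∧ ∀ x, f x ≠ x → a ≤ x ∧ x ≤ b := by
  have hne : (fixedBy ℕ f)ᶜ.Nonempty := by
    by_contra! h
    exact hf1 (Perm.ext fun i => by_contra fun hi => Set.eq_empty_iff_forall_notMem.1 h i hi)
  obtain ⟨a, ha, hmin⟩ := Set.exists_min_image _ id hf hne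
  obtain ⟨b, hb, hmax⟩ := Set.exists_max_image _ id hf hne
  exact ⟨a, b, ha, hb, fun x hx => ⟨hmin x hx, hmax x hx⟩⟩

theorem commutator_translate {f : Perm ℕ} {a b : ℕ} (ha : f a ≠ a) (hb : f b ≠ b)
    (h : ∀ x, f x ≠ x → a ≤ x ∧ x ≤ b) :
    ⁅f, f.viaEmbedding (addLeftEmbedding (b - a))⁆ =
      (gapCycle (b - f b - 1) (f a - a - 1)).viaEmbedding (addLeftEmbedding (f b)) := by
  set g := f.viaEmbedding (addLeftEmbedding (b - a)) with hg
  have hfa := h (f a) fun h' => ha (f.injective h')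
  have hfb := h (f b) fun h' => hb (f.injective h')
  have hab := h a ha
  have hgb : g b = b - a + f a := by
    have := viaEmbedding_apply f (addLeftEmbedding (b - a)) a
    rwa [addLeftEmbedding_apply, Nat.sub_add_cancel hab.2] at this
  have hgx : ∀ x < b, g x = x := fun x hx => by
    by_cases hxr : x ∈ Set.range (addLeftEmbedding (b - a))
    · obtain ⟨y, rfl⟩ := hxr
      rw [addLeftEmbedding_apply] at hx
      have hy : f y = y := by_contra fun hy => by have := h y hy; omega
      rw [hg, viaEmbedding_apply, hy]
    · exact viaEmbedding_apply_of_notMem _ _ _ hxr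
  have hfg : ∀ x ≠ b, f x = x ∨ g x = x := fun x hx => by
    rcases hx.lt_or_gt with hlt | hgt
    · exact .inr (hgx x hlt)
    · exact .inl (by_contra fun hx => hgt.not_ge (h x hx).2)
  rw [commutator_eq_swap_mul_swap hfg (by omega)]
  simp only [gapCycle, viaEmbedding_mul, viaEmbedding_swap, addLeftEmbedding_apply, hgb]
  grind

instance {k : ℕ} (p : Fin (k + 1)) (τ : Perm (Fin (k + 1))) (σ : Perm (Fin k)) :
    Decidable (RemovesString p τ σ) :=
  inferInstanceAs (Decidable (∀ j, τ (p.succAbove j) = (τ p).succAbove (σ j)))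

namespace FilteredSubgroup

variable {G : FilteredSubgroup}

theorem exists_gapCycle_mem (hG : StableRemovingOuter G) {f : Perm ℕ} (hf : f ∈ G.union)
    (hf1 : f ≠ 1) : ∃ u v, gapCycle u v ∈ G.union := by
  obtain ⟨a, b, ha, hb, h⟩ := exists_extreme_moved (finite_compl_fixedBy_of_mem_union hf) hf1
  have hcomm := Subgroup.commutator_le_self _ <|
    Subgroup.commutator_mem_commutator hf (translate_mem_union hf (b - a))
  rw [commutator_translate ha hb h] at hcomm
  exact ⟨_, _, mem_union_of_translate_mem hG hcomm⟩

theorem swap_mem_of_gapCycle_mem (hG : StableRemovingNeighbours G) :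
    ∀ u v, gapCycle u v ∈ G.union →
      swap (0 : Fin 2) 1 ∈ G.level 2 ∨ swap (0 : Fin 3) 2 ∈ G.level 3
  | u + 2, v, h => by
    rw [← gapCycle_viaEmbedding_skipTwo_left] at h
    exact swap_mem_of_gapCycle_mem hG u v (mem_union_of_viaEmbedding_skipTwo_mem hG h)
  | u, v + 2, h => by
    rw [← gapCycle_viaEmbedding_skipTwo_right] at h
    exact swap_mem_of_gapCycle_mem hG u v (mem_union_of_viaEmbedding_skipTwo_mem hG h)
  | 0, 0, h => by
    let τ : Perm (Fin 3) := swap 0 2 * swap 1 2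
    have hτ : τ ∈ G.level 3 :=
      toPermNat_mem_union.1 (by simpa [τ, gapCycle, toPermNat_swap] using h)
    -- the product of `τ` and its translate is `(0 1)(2 3)`
    have hτ' : concat (1 : Perm (Fin 1)) τ * concat τ (1 : Perm (Fin 1)) ∈ G.level 4 :=
      mul_mem (G.concat_mem (one_mem _) hτ) (G.concat_mem hτ (one_mem (G.level 1)))
    exact .inl (hG 2 2 _ (swap 0 1) _ hτ' (by decide) (by decide) (by decide))
  | 0, 1, h => by
    have hτ : swap (0 : Fin 4) 3 * swap 1 3 ∈ G.level 4 :=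
      toPermNat_mem_union.1 (by simpa [gapCycle, toPermNat_swap] using h)
    exact .inl (hG 2 2 _ (swap 0 2 * swap 1 2) _ hτ (by decide) (by decide) (by decide))
  | 1, 0, h => by
    have hτ : swap (0 : Fin 4) 3 * swap 2 3 ∈ G.level 4 :=
      toPermNat_mem_union.1 (by simpa [gapCycle, toPermNat_swap] using h)
    exact .inl (hG 2 1 _ (swap 0 2 * swap 1 2) _ hτ (by decide) (by decide) (by decide))
  | 1, 1, h => by
    have hτ : swap (0 : Fin 5) 4 * swap 2 4 ∈ G.level 5 :=
      toPermNat_mem_union.1 (by simpa [gapCycle, toPermNat_swap] using h)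
    exact .inr (hG 3 1 _ (swap 0 3 * swap 1 3) _ hτ (by decide) (by decide) (by decide))

end FilteredSubgroup

/-! ### Classification of the stable filtered subgroups -/

theorem mem_of_forall_swap_mem {α : Type*} [DecidableEq α] {H : Subgroup (Perm α)} {f : Perm α}
    (hf : (fixedBy α f)ᶜ.Finite) (h : ∀ x, swap (f x) x ∈ H) : f ∈ H := by
  have hS : Subgroup.closure {g | g ∈ H ∧ g.IsSwap} ≤ H :=
    (Subgroup.closure_le H).2 fun g hg => hg.1
  refine hS ((mem_closure_isSwap fun g hg => hg.2).2 ⟨hf, fun x => ?_⟩)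
  rcases eq_or_ne (f x) x with hx | hx
  · rw [hx]
    exact mem_orbit_self x
  · exact ⟨⟨swap (f x) x, Subgroup.subset_closure ⟨h x, _, _, hx, rfl⟩⟩, swap_apply_right _ _⟩

namespace FilteredSubgroup

variable {G : FilteredSubgroup}

theorem swap_mem_union_of_modEq {d : ℕ} (h : swap 0 d ∈ G.union) {i j : ℕ}
    (hij : i ≡ j [MOD d]) : swap i j ∈ G.union := by
  wlog hle : i ≤ j generalizing i j
  · rw [swap_comm]
    exact this hij.symm (by omega)
  obtain ⟨n, hn⟩ := (Nat.modEq_iff_dvd' hle).1 hij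
  obtain rfl : j = i + d * n := by omega
  clear hij hle hn
  induction n with
  | zero =>
    rw [mul_zero, add_zero, swap_self]
    exact one_mem _
  | succ n ih =>
    refine SubmonoidClass.swap_mem_trans _ ih ?_
    have := translate_mem_union h (i + d * n)
    rwa [viaEmbedding_swap, addLeftEmbedding_apply, addLeftEmbedding_apply, add_zero,
      add_assoc, ← mul_add_one] at this

theorem mem_level_of_forall_modEq {d : ℕ} (h : swap 0 d ∈ G.union) {k : ℕ} {σ : Perm (Fin k)}
    (hσ : ∀ i, (σ i : ℕ) ≡ i [MOD d]) : σ ∈ G.level k := by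
  refine toPermNat_mem_union.1 <| mem_of_forall_swap_mem (finite_compl_fixedBy_toPermNat σ)
    fun i => swap_mem_union_of_modEq h ?_
  rcases lt_or_ge i k with hi | hi
  · exact toPermNat_apply σ ⟨i, hi⟩ ▸ hσ ⟨i, hi⟩
  · rw [toPermNat_apply_of_le σ hi]

theorem eq_fullGroup_of_swap_mem (h : swap (0 : Fin 2) 1 ∈ G.level 2) : G = fullGroup := by
  rw [← toPermNat_mem_union, toPermNat_swap] at h
  ext k σ
  exact iff_of_true (mem_level_of_forall_modEq h fun _ => Nat.modEq_one) (Subgroup.mem_top σ)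

theorem parityGroup_level_le_of_swap_mem (h : swap (0 : Fin 3) 2 ∈ G.level 3) (k : ℕ) :
    parityGroup.level k ≤ G.level k := by
  rw [← toPermNat_mem_union, toPermNat_swap] at h
  exact fun σ hσ => mem_level_of_forall_modEq h hσ

theorem swap_zero_one_mem_union (h : swap 0 2 ∈ G.union) {i j : ℕ} (hij : ¬ i ≡ j [MOD 2])
    (hs : swap i j ∈ G.union) : swap 0 1 ∈ G.union := by
  wlog hi : 0 ≡ i [MOD 2] generalizing i j
  · refine this (fun hji => hij hji.symm) (swap_comm i j ▸ hs) ?_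
    unfold Nat.ModEq at *
    omega
  have hj : j ≡ 1 [MOD 2] := by
    unfold Nat.ModEq at *
    omega
  exact SubmonoidClass.swap_mem_trans _ (swap_mem_union_of_modEq h hi)
    (SubmonoidClass.swap_mem_trans _ hs (swap_mem_union_of_modEq h hj))

theorem eq_parityGroup_or_eq_fullGroup_of_swap_mem (h : swap (0 : Fin 3) 2 ∈ G.level 3) :
    G = parityGroup ∨ G = fullGroup := by
  by_cases hle : ∀ k, G.level k ≤ parityGroup.level k
  · left
    ext k σ
    exact ⟨fun hσ => hle k hσ, fun hσ => parityGroup_level_le_of_swap_mem h k hσ⟩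
  right
  obtain ⟨k, σ, hσ, hσ'⟩ : ∃ k, ∃ σ ∈ G.level k, σ ∉ parityGroup.level k := by
    simpa only [SetLike.le_def, not_forall, exists_prop] using hle
  obtain ⟨i, hi⟩ : ∃ i : Fin k, ¬ (σ i : ℕ) ≡ i [MOD 2] := not_forall.1 hσ'
  rw [← toPermNat_mem_union, toPermNat_swap] at h
  have hn : (i : ℕ) ≡ i + 2 * k [MOD 2] := by simp [Nat.ModEq]
  have hs := mul_mem (mul_mem (toPermNat_mem_union.2 hσ) (swap_mem_union_of_modEq h hn))
    (inv_mem (toPermNat_mem_union.2 hσ))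
  rw [← swap_apply_apply, toPermNat_apply, toPermNat_apply_of_le σ (by omega)] at hs
  refine eq_fullGroup_of_swap_mem (toPermNat_mem_union.1 ?_)
  rw [toPermNat_swap]
  exact swap_zero_one_mem_union h (fun h' => hi (h'.trans hn.symm)) hs

theorem eq_of_stable (hG : StableRemovingOuter G) (hG' : StableRemovingNeighbours G) :
    G = trivialGroup ∨ G = parityGroup ∨ G = fullGroup := by
  by_cases htriv : ∀ k, ∀ σ ∈ G.level k, σ = 1
  · left
    ext k σ
    exact ⟨htriv k σ, fun hσ => Subgroup.mem_bot.1 hσ ▸ one_mem _⟩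
  right
  push Not at htriv
  obtain ⟨k, σ, hσ, hσ1⟩ := htriv
  obtain ⟨u, v, huv⟩ := exists_gapCycle_mem hG (toPermNat_mem_union.2 hσ)
    ((map_ne_one_iff _ toPermNat_injective).2 hσ1)
  rcases swap_mem_of_gapCycle_mem hG' u v huv with h | h
  · exact .inr (eq_fullGroup_of_swap_mem h)
  · exact eq_parityGroup_or_eq_fullGroup_of_swap_mem h

end FilteredSubgroup

theorem RemovesString.eq_one {k : ℕ} {p : Fin (k + 1)} {σ : Perm (Fin k)}
    (h : RemovesString p 1 σ) : σ = 1 := by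
  ext j
  exact congrArg Fin.val (Fin.succAbove_right_injective (h j)).symm

theorem stableRemovingOuter_trivialGroup : StableRemovingOuter trivialGroup := by
  intro k τ σ hτ h
  obtain rfl : τ = 1 := hτ
  rcases h with ⟨-, h⟩ | ⟨-, h⟩ <;> exact h.eq_one

theorem stableRemovingNeighbours_trivialGroup : StableRemovingNeighbours trivialGroup := by
  intro k p τ ρ σ hτ _ hρ hσ
  obtain rfl : τ = 1 := hτ
  rw [hρ.eq_one] at hσ
  exact hσ.eq_one

theorem stableRemovingOuter_parityGroup : StableRemovingOuter parityGroup := by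
  rintro k τ σ hτ (⟨h0, h⟩ | ⟨h0, h⟩) j
  · have h1 := congrArg Fin.val (h j)
    have h2 := hτ (Fin.succAbove 0 j)
    rw [h0] at h1
    simp only [Fin.zero_succAbove, Fin.val_succ] at h1 h2
    omega
  · have h1 := congrArg Fin.val (h j)
    have h2 := hτ ((Fin.last k).succAbove j)
    rw [h0] at h1
    simp only [Fin.succAbove_last, Fin.val_castSucc] at h1 h2
    omega

theorem stableRemovingNeighbours_parityGroup : StableRemovingNeighbours parityGroup := by
  intro k p τ ρ σ hτ hn hρ hσ j
  have h1 := hρ p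
  have h2 := hρ (p.succAbove j)
  have h3 := hτ (p.succ.succAbove (p.succAbove j))
  rw [Fin.succAbove_succ_self] at h1
  rw [hσ j] at h2
  simp only [Fin.ext_iff, Fin.succAbove, Fin.lt_def] at h1 h2 h3 hn
  grind

theorem stable_iff (G : FilteredSubgroup) :
    (StableRemovingOuter G ∧ StableRemovingNeighbours G) ↔
      G = trivialGroup ∨ G = parityGroup ∨ G = fullGroup := by
  refine ⟨fun h => FilteredSubgroup.eq_of_stable h.1 h.2, ?_⟩
  rintro (rfl | rfl | rfl)
  · exact ⟨stableRemovingOuter_trivialGroup, stableRemovingNeighbours_trivialGroup⟩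
  · exact ⟨stableRemovingOuter_parityGroup, stableRemovingNeighbours_parityGroup⟩
  · exact ⟨fun _ _ _ _ _ => Subgroup.mem_top _, fun _ _ _ _ _ _ _ _ _ => Subgroup.mem_top _⟩

/-! ### Words satisfying relations -/

section InsertNth

variable {α : Type*} {k : ℕ}

theorem insertNth_castSucc_insertNth (p : Fin (k + 1)) (t : α) (i : Fin k → α) :
    (Fin.insertNth p.castSucc t (Fin.insertNth p t i : Fin (k + 1) → α) : Fin (k + 2) → α) =
      Fin.insertNth p.succ t (Fin.insertNth p t i : Fin (k + 1) → α) := by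
  refine Fin.eq_insertNth_iff.2 ⟨?_, funext fun j => ?_⟩
  · rw [← Fin.succAbove_castSucc_self p, Fin.insertNth_apply_succAbove, Fin.insertNth_apply_same]
  rw [Fin.removeNth]
  rcases Fin.eq_self_or_eq_succAbove p j with rfl | ⟨j, rfl⟩
  · rw [Fin.succAbove_succ_self, Fin.insertNth_apply_same, Fin.insertNth_apply_same]
  · have hj : p.succ.succAbove (p.succAbove j) = p.castSucc.succAbove (p.succAbove j) := by
      simp only [Fin.ext_iff, Fin.succAbove, Fin.lt_def]
      grind
    rw [hj, Fin.insertNth_apply_succAbove]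

theorem insertNth_comp_of_removesString {p : Fin (k + 1)} {τ : Perm (Fin (k + 1))}
    {σ : Perm (Fin k)} (h : RemovesString p τ σ) (t : α) (i : Fin k → α) :
    (Fin.insertNth (τ p) t i : Fin (k + 1) → α) ∘ τ = Fin.insertNth p t (i ∘ σ) := by
  refine Fin.eq_insertNth_iff.2 ⟨Fin.insertNth_apply_same _ _ _, funext fun j => ?_⟩
  rw [Fin.removeNth, Function.comp_apply, h j, Fin.insertNth_apply_succAbove]
  rfl

end InsertNth

section Word

variable {R ι : Type*} [Semiring R] (y : ι → R)

/-- The product `y i₁ ⋯ y iₖ`. -/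
def word {k : ℕ} (i : Fin k → ι) : R := (List.ofFn (y ∘ i)).prod

theorem word_append {k l : ℕ} (i : Fin k → ι) (j : Fin l → ι) :
    word y (Fin.append i j) = word y i * word y j := by
  simp only [word, ← List.prod_append, ← List.ofFn_fin_append]
  congr 2
  ext x
  induction x using Fin.addCases <;> simp

theorem word_cons {k : ℕ} (t : ι) (i : Fin k → ι) :
    word y (Fin.cons t i : Fin (k + 1) → ι) = y t * word y i := by
  simp [word, List.ofFn_succ, Function.comp_def]

theorem word_snoc {k : ℕ} (i : Fin k → ι) (t : ι) :
    word y (Fin.snoc i t : Fin (k + 1) → ι) = word y i * y t := by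
  rw [← Fin.append_right_eq_snoc i fun _ => t, word_append]
  simp [word]

theorem append_comp_concat {k l : ℕ} (σ : Perm (Fin k)) (π : Perm (Fin l)) (i : Fin k → ι)
    (j : Fin l → ι) : Fin.append i j ∘ concat σ π = Fin.append (i ∘ σ) (j ∘ π) := by
  ext x
  induction x using Fin.addCases with
  | left x => simp [concat_castAdd]
  | right x => simp [concat_natAdd]

variable [Fintype ι] {y}

section SumSq

variable (hy : ∑ t, y t ^ 2 = 1)

include hy

theorem eq_of_forall_mul_right_eq {a b : R} (h : ∀ t, a * y t = b * y t) : a = b := by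
  rw [← mul_one a, ← mul_one b, ← hy, Finset.mul_sum, Finset.mul_sum]
  simp only [pow_two, ← mul_assoc, h]

theorem eq_of_forall_mul_left_eq {a b : R} (h : ∀ t, y t * a = y t * b) : a = b := by
  rw [← one_mul a, ← one_mul b, ← hy, Finset.sum_mul, Finset.sum_mul]
  simp only [pow_two, mul_assoc, h]

theorem sum_word_cons_cons {k : ℕ} (i : Fin k → ι) :
    ∑ t, word y (Fin.cons t (Fin.cons t i : Fin (k + 1) → ι) : Fin (k + 2) → ι) = word y i := by
  simp_rw [word_cons, ← mul_assoc, ← pow_two, ← Finset.sum_mul, hy, one_mul]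

theorem sum_word_insertNth {k : ℕ} (p : Fin (k + 1)) (i : Fin k → ι) :
    ∑ t, word y (Fin.insertNth p.succ t (Fin.insertNth p t i : Fin (k + 1) → ι) :
      Fin (k + 2) → ι) = word y i := by
  rcases p.eq_zero_or_eq_succ with rfl | ⟨p, rfl⟩
  · simp_rw [Fin.insertNth_zero', Fin.insertNth_succ_cons, Fin.insertNth_zero',
      sum_word_cons_cons hy]
  induction k with
  | zero => exact p.elim0
  | succ k ih =>
    rw [← Fin.cons_self_tail i]
    simp_rw [Fin.insertNth_succ_cons, word_cons, ← Finset.mul_sum]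
    rcases p.eq_zero_or_eq_succ with rfl | ⟨p, rfl⟩
    · simp_rw [Fin.insertNth_zero', Fin.insertNth_succ_cons, Fin.insertNth_zero',
        sum_word_cons_cons hy]
    rw [ih]

end SumSq

/-- The filtered subgroup of the permutations `σ` such that the elements `y i` satisfy the
relations associated to `σ`. -/
def relationGroup (hy : ∑ t, y t ^ 2 = 1) : FilteredSubgroup where
  level k :=
    { carrier := {σ | ∀ i : Fin k → ι, word y i = word y (i ∘ σ)}
      mul_mem' := fun {σ _} hσ hπ i => (hσ i).trans (hπ (i ∘ σ))
      one_mem' := fun _ => rfl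
      inv_mem' := fun {σ} hσ i => by
        rw [hσ (i ∘ _), Function.comp_assoc, ← coe_mul, inv_mul_cancel, coe_one,
          Function.comp_id] }
  mem_succ_iff σ := by
    refine ⟨fun h i => eq_of_forall_mul_right_eq hy fun t => ?_, fun h i => ?_⟩
    · have ht := h (Fin.append i fun _ => t)
      rwa [append_comp_concat, Fin.append_right_eq_snoc, Fin.append_right_eq_snoc, word_snoc,
        word_snoc] at ht
    · rw [← Fin.append_castAdd_natAdd (f := i), append_comp_concat, word_append, word_append, ← h]
      rfl
  concat_mem hσ hπ i := by
    rw [← Fin.append_castAdd_natAdd (f := i), append_comp_concat, word_append, word_append, ← hσ,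
      ← hπ]

theorem mem_relationGroup {hy : ∑ t, y t ^ 2 = 1} {k : ℕ} {σ : Perm (Fin k)} :
    σ ∈ (relationGroup hy).level k ↔ ∀ i, word y i = word y (i ∘ σ) := Iff.rfl

theorem stableRemovingOuter_relationGroup (hy : ∑ t, y t ^ 2 = 1) :
    StableRemovingOuter (relationGroup hy) := by
  rintro k τ σ hτ (⟨h0, h⟩ | ⟨h0, h⟩) i
  · refine eq_of_forall_mul_left_eq hy fun t => ?_
    have hcons := insertNth_comp_of_removesString h t i
    rw [h0, Fin.insertNth_zero', Fin.insertNth_zero'] at hcons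
    rw [← word_cons, ← word_cons, ← hcons]
    exact hτ _
  · refine eq_of_forall_mul_right_eq hy fun t => ?_
    have hsnoc := insertNth_comp_of_removesString h t i
    rw [h0, Fin.insertNth_last', Fin.insertNth_last'] at hsnoc
    rw [← word_snoc, ← word_snoc, ← hsnoc]
    exact hτ _

theorem stableRemovingNeighbours_relationGroup (hy : ∑ t, y t ^ 2 = 1) :
    StableRemovingNeighbours (relationGroup hy) := by
  intro k p τ ρ σ hτ hn hρ hσ i
  have hq : τ p.succ = (ρ p).succ ∨ τ p.succ = (ρ p).castSucc := by
    have h1 := hρ p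
    rw [Fin.succAbove_succ_self] at h1
    simp only [Fin.ext_iff, Fin.succAbove, Fin.lt_def] at h1 ⊢
    grind
  have hins : ∀ t : ι, (Fin.insertNth (τ p.succ) t
      (Fin.insertNth (ρ p) t i : Fin (k + 1) → ι) : Fin (k + 2) → ι) =
        Fin.insertNth (ρ p).succ t (Fin.insertNth (ρ p) t i : Fin (k + 1) → ι) := fun t => by
    rcases hq with h | h
    · rw [h]
    · rw [h, insertNth_castSucc_insertNth]
  rw [← sum_word_insertNth hy (ρ p) i, ← sum_word_insertNth hy p]
  refine Finset.sum_congr rfl fun t _ => ?_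
  rw [← hins, hτ, insertNth_comp_of_removesString hρ, insertNth_comp_of_removesString hσ]

end Word

/-! ### Ideals with commutative quotient -/

section Characters

/-- The Banach algebra quotient by a closed two-sided ideal containing all the commutators. -/
abbrev quotientNormedCommRing {A : Type*} [NormedRing A] (I : Ideal A) [I.IsTwoSided]
    (hI : IsClosed (I : Set A)) (hcomm : ∀ a b : A, a * b - b * a ∈ I) :
    NormedCommRing (A ⧸ I) :=
  { Submodule.Quotient.normedAddCommGroup I, Ideal.Quotient.ring I with
    mul_comm := by
      intro x y
      obtain ⟨x, rfl⟩ := Ideal.Quotient.mk_surjective x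
      obtain ⟨y, rfl⟩ := Ideal.Quotient.mk_surjective y
      rw [← map_mul, ← map_mul]
      exact Ideal.Quotient.eq.2 (hcomm x y)
    norm_mul_le := by
      refine fun x y => le_mul_of_forall_lt₀ fun r hr s hs => ?_
      obtain ⟨a, rfl, ha⟩ := Submodule.Quotient.norm_mk_lt x (sub_pos.2 hr)
      obtain ⟨b, rfl, hb⟩ := Submodule.Quotient.norm_mk_lt y (sub_pos.2 hs)
      rw [add_sub_cancel] at ha hb
      calc ‖Ideal.Quotient.mk I (a * b)‖ ≤ ‖a * b‖ := Submodule.Quotient.norm_mk_le I (a * b)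
        _ ≤ ‖a‖ * ‖b‖ := norm_mul_le a b
        _ ≤ r * s := by gcongr; exact (norm_nonneg a).trans ha.le }

theorem exists_character_of_not_isUnit_mk {A : Type*} [NormedRing A] [NormedAlgebra ℂ A]
    [CompleteSpace A] {I : Ideal A} [I.IsTwoSided] (hI : IsClosed (I : Set A))
    (hcomm : ∀ a b : A, a * b - b * a ∈ I) {a : A} (ha : ¬IsUnit (Ideal.Quotient.mk I a)) :
    ∃ χ : A →ₐ[ℂ] ℂ, (∀ x ∈ I, χ x = 0) ∧ χ a = 0 := by
  let _ : NormedCommRing (A ⧸ I) := quotientNormedCommRing I hI hcomm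
  let _ : NormedAlgebra ℂ (A ⧸ I) :=
    { Ideal.Quotient.algebra ℂ with
      norm_smul_le := (Submodule.Quotient.normedSpace I ℂ).norm_smul_le }
  have _ : CompleteSpace (A ⧸ I) := Submodule.Quotient.completeSpace I
  obtain ⟨f, hf⟩ := WeakDual.CharacterSpace.exists_apply_eq_zero ha
  let φ : A ⧸ I →ₐ[ℂ] ℂ := WeakDual.CharacterSpace.toAlgHom f
  refine ⟨φ.comp (Ideal.Quotient.mkₐ ℂ I), fun x hx => ?_, hf⟩
  rw [AlgHom.comp_apply, Ideal.Quotient.mkₐ_eq_mk, Ideal.Quotient.eq_zero_iff_mem.2 hx, map_zero]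

/-- The soft thresholding function: it vanishes on `[-ε, ε]` and is within `ε` of the identity. -/
def softThreshold (ε t : ℝ) : ℝ := t - max (-ε) (min t ε)

/-- The tent function of height `1` supported on `[-ε, ε]`. -/
def tent (ε t : ℝ) : ℝ := max 0 (1 - |t| / ε)

theorem continuous_softThreshold (ε : ℝ) : Continuous (softThreshold ε) := by
  unfold softThreshold
  fun_prop

theorem continuous_tent (ε : ℝ) : Continuous (tent ε) := by
  unfold tent
  fun_prop

theorem tent_zero (ε : ℝ) : tent ε 0 = 1 := by simp [tent]

theorem tent_mul_softThreshold {ε : ℝ} (hε : 0 < ε) (t : ℝ) :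
    tent ε t * softThreshold ε t = 0 := by
  rw [tent, softThreshold]
  rcases le_total |t| ε with h | h
  · rw [min_eq_left (abs_le.1 h).2, max_eq_right (abs_le.1 h).1, sub_self, mul_zero]
  · rw [max_eq_left (sub_nonpos.2 ((one_le_div hε).2 h)), zero_mul]

variable {A : Type*} [CStarAlgebra A]

theorem norm_sub_cfc_softThreshold_le {a : A} (ha : IsSelfAdjoint a) {ε : ℝ} (hε : 0 ≤ ε) :
    ‖a - cfc (softThreshold ε) a‖ ≤ ε := by
  have hclamp : a - cfc (softThreshold ε) a = cfc (fun t => max (-ε) (min t ε)) a := by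
    nth_rewrite 1 [← cfc_id ℝ a]
    rw [← cfc_sub id _ a (by fun_prop) (continuous_softThreshold ε).continuousOn]
    simp only [id, softThreshold, sub_sub_cancel]
  rw [hclamp]
  refine norm_cfc_le hε fun t _ => abs_le.2 ⟨le_max_left _ _, max_le ?_ (min_le_right _ _)⟩
  exact neg_le_self hε

theorem character_cfc_of_apply_eq_zero (χ : A →⋆ₐ[ℂ] ℂ) {a : A} (ha : IsSelfAdjoint a)
    (hχ : χ a = 0) {f : ℝ → ℝ} (hf : Continuous f) : χ (cfc f a) = f 0 := by
  have hcont : Continuous χ := map_continuous χ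
  rw [StarAlgHomClass.map_cfc χ f a hf.continuousOn hcont ha (by rw [hχ]; exact .zero ℂ), hχ,
    cfc_apply_zero, Complex.coe_algebraMap]

theorem cfc_softThreshold_mem {I : Ideal A} [I.IsTwoSided] (hI : IsClosed (I : Set A))
    (hcomm : ∀ a b : A, a * b - b * a ∈ I) {a : A} (ha : IsSelfAdjoint a)
    (hχ : ∀ χ : A →⋆ₐ[ℂ] ℂ, (∀ x ∈ I, χ x = 0) → χ a = 0) {ε : ℝ} (hε : 0 < ε) :
    cfc (softThreshold ε) a ∈ I := by
  by_contra hmem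
  have hmul : cfc (tent ε) a * cfc (softThreshold ε) a = 0 := by
    rw [← cfc_mul (tent ε) _ a (continuous_tent ε).continuousOn
      (continuous_softThreshold ε).continuousOn, funext (tent_mul_softThreshold hε),
      cfc_const_zero]
  have hunit : ¬IsUnit (Ideal.Quotient.mk I (cfc (tent ε) a)) := fun hu =>
    hmem <| Ideal.Quotient.eq_zero_iff_mem.1 <| hu.mul_right_eq_zero.1 <| by
      rw [← map_mul, hmul, map_zero]
  obtain ⟨χ, hχI, hχtent⟩ := exists_character_of_not_isUnit_mk hI hcomm hunit
  let ψ : A →⋆ₐ[ℂ] ℂ := { χ with map_star' := map_star χ }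
  have hψ : ψ (cfc (tent ε) a) = 1 := by
    rw [character_cfc_of_apply_eq_zero ψ ha (hχ ψ hχI) (continuous_tent ε), tent_zero,
      Complex.ofReal_one]
  exact zero_ne_one (hχtent.symm.trans hψ)

theorem mem_of_isSelfAdjoint_of_forall_character {I : Ideal A} [I.IsTwoSided]
    (hI : IsClosed (I : Set A)) (hcomm : ∀ a b : A, a * b - b * a ∈ I) {a : A}
    (ha : IsSelfAdjoint a) (hχ : ∀ χ : A →⋆ₐ[ℂ] ℂ, (∀ x ∈ I, χ x = 0) → χ a = 0) : a ∈ I := by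
  rw [← SetLike.mem_coe, ← hI.closure_eq, Metric.mem_closure_iff]
  intro ε hε
  refine ⟨_, cfc_softThreshold_mem hI hcomm ha hχ (half_pos hε), ?_⟩
  rw [dist_eq_norm]
  exact (norm_sub_cfc_softThreshold_le ha (half_pos hε).le).trans_lt (half_lt_self hε)

theorem mem_of_forall_character {I : Ideal A} [I.IsTwoSided] (hI : IsClosed (I : Set A))
    (hcomm : ∀ a b : A, a * b - b * a ∈ I) {a : A}
    (hχ : ∀ χ : A →⋆ₐ[ℂ] ℂ, (∀ x ∈ I, χ x = 0) → χ a = 0) : a ∈ I := by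
  rw [← realPart_add_I_smul_imaginaryPart a]
  refine add_mem ?_ (Submodule.smul_of_tower_mem I Complex.I ?_)
  · refine mem_of_isSelfAdjoint_of_forall_character hI hcomm (realPart a).2 fun χ hχI => ?_
    rw [realPart_apply_coe, ← Complex.coe_smul, map_smul, map_add, map_star, hχ χ hχI,
      star_zero, add_zero, smul_zero]
  · refine mem_of_isSelfAdjoint_of_forall_character hI hcomm (imaginaryPart a).2 fun χ hχI => ?_
    rw [imaginaryPart_apply_coe, map_smul, ← Complex.coe_smul, map_smul, map_sub, map_star,
      hχ χ hχI, star_zero, sub_zero, smul_zero, smul_zero]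

end Characters

section RealSphere

theorem commutator_mem_of_dense_adjoin {R A : Type*} [CommSemiring R] [Ring A] [Algebra R A]
    [TopologicalSpace A] [IsTopologicalRing A] {s : Set A}
    (hs : Dense (Algebra.adjoin R s : Set A)) {I : Ideal A} [I.IsTwoSided]
    (hI : IsClosed (I : Set A)) (h : ∀ a ∈ s, ∀ b ∈ s, a * b - b * a ∈ I) (a b : A) :
    a * b - b * a ∈ I := by
  have hadjoin : ∀ a b : Algebra.adjoin R s, (a * b - b * a : A) ∈ I := by
    rintro ⟨a, ha⟩ ⟨b, hb⟩
    have hcomm := Algebra.isMulCommutative_adjoin R (s := Ideal.Quotient.mkₐ R I '' s) (by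
      rintro _ ⟨a, ha, rfl⟩ _ ⟨b, hb, rfl⟩
      exact Ideal.Quotient.eq.2 (h a ha b hb))
    rw [← AlgHom.map_adjoin] at hcomm
    have hmk := isMulCommutative_iff_of_setLike.1 hcomm _ ⟨a, ha, rfl⟩ _ ⟨b, hb, rfl⟩
    exact Ideal.Quotient.eq.1 hmk
  exact hs.denseRange_val.induction_on₂
    (hI.preimage (f := fun q : A × A => q.1 * q.2 - q.2 * q.1) (by fun_prop)) hadjoin a b

variable {N : ℕ}

theorem dense_adjoin_coord :
    Dense (Algebra.adjoin ℂ (Set.range (coord (N := N))) : Set (FreeSphereAlg N)) := by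
  have hstar : star (Set.range (coord (N := N))) = Set.range coord := by
    rw [← Set.image_star, ← Set.range_comp]
    exact congrArg Set.range (funext star_coord)
  have hadjoin : (Algebra.adjoin ℂ (Set.range (coord (N := N))) : Set (FreeSphereAlg N)) =
      (StarAlgebra.adjoin ℂ (Set.range coord) : StarSubalgebra ℂ (FreeSphereAlg N)) := by
    rw [← StarSubalgebra.coe_toSubalgebra, StarAlgebra.adjoin_toSubalgebra, hstar, Set.union_self]
  have hmap := StarAlgHom.map_adjoin (StarSubalgebra.subtype _) (Set.range (coord (N := N)))
  rw [← Set.range_comp] at hmap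
  rw [hadjoin, Subtype.dense_iff]
  exact closure_mono (congrArg SetLike.coe hmap).ge

theorem exists_realPoint (χ : FreeSphereAlg N →⋆ₐ[ℂ] ℂ) :
    ∃ p : RealPoint N, χ = evalModel (pointModel p) := by
  have hre : ∀ i, χ (coord i) = ((χ (coord i)).re : ℂ) := fun i => by
    rw [eq_comm, ← Complex.conj_eq_iff_re, starRingEnd_apply, ← map_star, star_coord]
  have hsum : ∑ i, (χ (coord i)).re ^ 2 = 1 := by
    have hsum : ∑ i, ((χ (coord i)).re : ℂ) ^ 2 = 1 := by
      simp_rw [← hre, ← map_pow, ← map_sum, sum_coord_sq, map_one]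
    exact_mod_cast hsum
  exact ⟨⟨fun i => (χ (coord i)).re, hsum⟩, eq_evalModel (pointModel _) χ hre⟩

theorem mem_realSphere {a : FreeSphereAlg N} :
    a ∈ (realSphere N).ideal ↔ ∀ p : RealPoint N, evalModel (pointModel p) a = 0 :=
  (TwoSidedIdeal.mem_iInf _).trans
    (forall_congr' fun p => TwoSidedIdeal.mem_ker (evalModel (pointModel p)))

theorem realSphere_ideal_le {S : ClosedSubspace N}
    (h : ∀ i j : Fin N, coord i * coord j - coord j * coord i ∈ S.ideal) :
    (realSphere N).ideal ≤ S.ideal := by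
  have hcomm : ∀ a b, a * b - b * a ∈ S.ideal.asIdeal :=
    commutator_mem_of_dense_adjoin dense_adjoin_coord S.isClosed <| by
      rintro _ ⟨i, rfl⟩ _ ⟨j, rfl⟩
      exact h i j
  refine fun a ha => mem_of_forall_character (I := S.ideal.asIdeal) S.isClosed hcomm fun χ _ => ?_
  obtain ⟨p, rfl⟩ := exists_realPoint χ
  exact mem_realSphere.1 ha p

end RealSphere

/-! ### Monomial spheres -/

section Sphere

variable {N : ℕ}

theorem sub_mem_cutOut_ideal {R : Set (FreeSphereAlg N × FreeSphereAlg N)}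
    {r : FreeSphereAlg N × FreeSphereAlg N} (hr : r ∈ R) : r.1 - r.2 ∈ (cutOut R).ideal :=
  (TwoSidedIdeal.mem_sInf _).2 fun _ hI => hI.2 r hr

theorem cutOut_ideal_le {R : Set (FreeSphereAlg N × FreeSphereAlg N)} {S : ClosedSubspace N}
    (h : ∀ r ∈ R, r.1 - r.2 ∈ S.ideal) : (cutOut R).ideal ≤ S.ideal :=
  fun _ ha => (TwoSidedIdeal.mem_sInf _).1 ha _ ⟨S.isClosed, h⟩

/-- The coordinates on a closed subspace of the free sphere. -/
def quotientCoord (S : ClosedSubspace N) (t : Fin N) : FreeSphereAlg N ⧸ S.ideal.asIdeal :=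
  Ideal.Quotient.mk S.ideal.asIdeal (coord t)

theorem sum_quotientCoord_sq (S : ClosedSubspace N) : ∑ t, quotientCoord S t ^ 2 = 1 := by
  rw [← map_one (Ideal.Quotient.mk S.ideal.asIdeal), ← sum_coord_sq, map_sum]
  exact Finset.sum_congr rfl fun t _ => (map_pow _ _ _).symm

theorem word_quotientCoord (S : ClosedSubspace N) {k : ℕ} (i : Fin k → Fin N) :
    word (quotientCoord S) i = Ideal.Quotient.mk S.ideal.asIdeal (monomial i) := by
  rw [monomial, map_list_prod, List.map_ofFn]
  rfl

/-- The filtered subgroup of the permutations whose relations hold on a closed subspace. -/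
def sphereGroup (S : ClosedSubspace N) : FilteredSubgroup :=
  relationGroup (sum_quotientCoord_sq S)

theorem mem_sphereGroup {S : ClosedSubspace N} {k : ℕ} {σ : Perm (Fin k)} :
    σ ∈ (sphereGroup S).level k ↔ ∀ r ∈ permRelations N σ, r.1 - r.2 ∈ S.ideal := by
  simp only [sphereGroup, mem_relationGroup, word_quotientCoord, Ideal.Quotient.eq,
    TwoSidedIdeal.mem_asIdeal, permRelations, Set.mem_ofPred_eq, forall_exists_index,
    forall_eq_apply_imp_iff]
  rfl

theorem mem_sphereGroup_cutOut {k : ℕ} (σ : Perm (Fin k)) :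
    σ ∈ (sphereGroup (cutOut (permRelations N σ))).level k :=
  mem_sphereGroup.2 fun _ => sub_mem_cutOut_ideal

theorem sphereGroup_cases (S : ClosedSubspace N) :
    sphereGroup S = trivialGroup ∨ sphereGroup S = parityGroup ∨ sphereGroup S = fullGroup :=
  (stable_iff _).1 ⟨stableRemovingOuter_relationGroup _, stableRemovingNeighbours_relationGroup _⟩

/-- The monomial sphere defined by all the relations associated to a filtered subgroup. -/
def FilteredSubgroup.sphere (N : ℕ) (G : FilteredSubgroup) : ClosedSubspace N :=
  cutOut (⋃ σ ∈ {σ : Σ k : ℕ, Perm (Fin k) | σ.2 ∈ G.level σ.1}, permRelations N σ.2)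

theorem isMonomialSphere_sphere (G : FilteredSubgroup) : IsMonomialSphere (G.sphere N) :=
  ⟨_, rfl⟩

theorem sphere_ideal_le_iff {G : FilteredSubgroup} {S : ClosedSubspace N} :
    (G.sphere N).ideal ≤ S.ideal ↔ ∀ k, G.level k ≤ (sphereGroup S).level k := by
  refine ⟨fun h k σ hσ => mem_sphereGroup.2 fun r hr => h ?_, fun h => cutOut_ideal_le ?_⟩
  · exact sub_mem_cutOut_ideal (Set.mem_biUnion (x := (⟨k, σ⟩ : Σ k : ℕ, Perm (Fin k))) hσ hr)
  · intro r hr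
    obtain ⟨⟨k, σ⟩, hσ, hr⟩ := Set.mem_iUnion₂.1 hr
    exact mem_sphereGroup.1 (h k hσ) r hr

theorem IsMonomialSphere.sphere_sphereGroup {S : ClosedSubspace N} (hS : IsMonomialSphere S) :
    (sphereGroup S).sphere N = S := by
  refine ClosedSubspace.ext (le_antisymm (sphere_ideal_le_iff.2 fun k => le_rfl) ?_)
  obtain ⟨E, rfl⟩ := hS
  refine cutOut_ideal_le fun r hr => sub_mem_cutOut_ideal ?_
  obtain ⟨σ, hσ, hr⟩ := Set.mem_iUnion₂.1 hr
  refine Set.mem_biUnion (x := σ) (mem_sphereGroup.2 fun r hr => ?_) hr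
  exact sub_mem_cutOut_ideal (Set.mem_biUnion hσ hr)

theorem sphere_eq_cutOut {G : FilteredSubgroup} {k : ℕ} {σ : Perm (Fin k)} (hσ : σ ∈ G.level k)
    (h : ∀ l, G.level l ≤ (sphereGroup (cutOut (permRelations N σ))).level l) :
    G.sphere N = cutOut (permRelations N σ) :=
  ClosedSubspace.ext <| le_antisymm (sphere_ideal_le_iff.2 h) <|
    cutOut_ideal_le <| mem_sphereGroup.1 <| sphere_ideal_le_iff.1 le_rfl k hσ

theorem sphere_trivialGroup : trivialGroup.sphere N = freeSphere N :=
  ClosedSubspace.ext <| le_antisymm (sphere_ideal_le_iff.2 fun _ => bot_le) bot_le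

theorem monomial_two (i : Fin 2 → Fin N) : monomial i = coord (i 0) * coord (i 1) := by
  simp [monomial, List.ofFn_succ]

theorem monomial_three (i : Fin 3 → Fin N) :
    monomial i = coord (i 0) * coord (i 1) * coord (i 2) := by
  simp [monomial, List.ofFn_succ, mul_assoc]

theorem halfLiberatedSphere_eq_cutOut :
    halfLiberatedSphere N = cutOut (permRelations N (swap (0 : Fin 3) 2)) := by
  refine congrArg cutOut (Set.ext fun r => ⟨?_, ?_⟩)
  · rintro ⟨i, j, k, rfl⟩
    exact ⟨![i, j, k], by rw [monomial_three, monomial_three]; rfl⟩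
  · rintro ⟨i, rfl⟩
    exact ⟨i 0, i 1, i 2, by rw [monomial_three, monomial_three]; rfl⟩

theorem realSphere_eq_cutOut :
    realSphere N = cutOut (permRelations N (swap (0 : Fin 2) 1)) := by
  refine ClosedSubspace.ext (le_antisymm (realSphere_ideal_le fun i j => ?_) ?_)
  · refine sub_mem_cutOut_ideal (r := (coord i * coord j, coord j * coord i)) ⟨![i, j], ?_⟩
    rw [monomial_two, monomial_two]
    rfl
  · refine cutOut_ideal_le ?_
    rintro _ ⟨i, rfl⟩
    refine mem_realSphere.2 fun p => ?_
    rw [monomial_two, monomial_two, map_sub, map_mul, map_mul, sub_eq_zero]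
    exact mul_comm (G := ℂ) _ _

theorem sphere_parityGroup : parityGroup.sphere N = halfLiberatedSphere N := by
  have hswap : swap (0 : Fin 3) 2 ∈ parityGroup.level 3 :=
    show ∀ i : Fin 3, (swap (0 : Fin 3) 2 i).val % 2 = i.val % 2 by decide
  rw [halfLiberatedSphere_eq_cutOut]
  exact sphere_eq_cutOut hswap
    (FilteredSubgroup.parityGroup_level_le_of_swap_mem (mem_sphereGroup_cutOut _))

theorem sphere_fullGroup : fullGroup.sphere N = realSphere N := by
  have hfull := FilteredSubgroup.eq_fullGroup_of_swap_mem
    (mem_sphereGroup_cutOut (N := N) (swap (0 : Fin 2) 1))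
  rw [realSphere_eq_cutOut]
  exact sphere_eq_cutOut (Subgroup.mem_top _) fun l => by rw [hfull]

theorem isMonomialSphere_iff (S : ClosedSubspace N) :
    IsMonomialSphere S ↔ S = realSphere N ∨ S = halfLiberatedSphere N ∨ S = freeSphere N := by
  rw [← sphere_fullGroup, ← sphere_parityGroup, ← sphere_trivialGroup]
  refine ⟨fun hS => ?_, ?_⟩
  · rw [← hS.sphere_sphereGroup]
    rcases sphereGroup_cases S with h | h | h <;> simp only [h, true_or, or_true]
  · rintro (rfl | rfl | rfl) <;> exact isMonomialSphere_sphere _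

end Sphere

end MonomialSphere

end

theorem theorem2p8 :
    (∀ (N : ℕ) (S : MonomialSphere.ClosedSubspace N),
      MonomialSphere.IsMonomialSphere S ↔
        S = MonomialSphere.realSphere N ∨ S = MonomialSphere.halfLiberatedSphere N ∨
          S = MonomialSphere.freeSphere N) ∧
    (∀ G : MonomialSphere.FilteredSubgroup,
      (MonomialSphere.StableRemovingOuter G ∧ MonomialSphere.StableRemovingNeighbours G) ↔
        G = MonomialSphere.trivialGroup ∨ G = MonomialSphere.parityGroup ∨
          G = MonomialSphere.fullGroup) :=
  ⟨fun _ S => MonomialSphere.isMonomialSphere_iff S, MonomialSphere.stable_iff⟩
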